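/- For all positive integers $n$ and non-negative integers $k$, let $A=(A_{i,j})_{0\le i,j\le n-1}$ be the matrix with $A_{0,0}=0$ and $$A_{i,j}=\frac{2k+2}{i+j+k+1}\binom{2i+2j-1}{i+j+k}\qquad\text{for }(i,j)\ne(0,0).$$ Then $$\det_{0\le i,j\le n-1}(A_{i,j})=\begin{cases} (-1)^{n_1\binom{k+1}{2}+1}(n_1-1), & \text{if } n=(k+1)n_1,\\ (-1)^{n_1\binom{k+1}{2}+k+1}\,n_1, & \text{if } n=(k+1)n_1+1,\\ 0, & \text{if } n\not\equiv 0,1 \pmod{k+1}, \end{cases}$$ where $n_1$ denotes a non-negative integer. (For $k=0$ both of the first two cases apply, and they give the same value.) -/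

import Mathlib

/-- The `n × n` rational matrix, with rows and columns indexed by `0, …, n - 1`, whose `(i, j)` entry
is `(2k+2)/(i+j+k+1) * binom(2i+2j-1, i+j+k)`, except that the `(0, 0)` entry is `0` by definition.
(Away from `(0, 0)` one has `2i+2j-1 ≥ 1`, so the subtraction in `ℕ` is the true one.) -/
def ballotHankel (n k : ℕ) : Matrix (Fin n) (Fin n) ℚ :=
  Matrix.of fun i j =>
    if (i : ℕ) = 0 ∧ (j : ℕ) = 0 then 0
    else (2 * (k : ℚ) + 2) / (((i : ℕ) : ℚ) + ((j : ℕ) : ℚ) + (k : ℚ) + 1)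
      * (Nat.choose (2 * (i : ℕ) + 2 * (j : ℕ) - 1) ((i : ℕ) + (j : ℕ) + k) : ℚ)

/-! Put `K = k + 1`. The entries are moments `L (X ^ (i + j))` of the functional with `L 1 = 0` and
`L (X * p)` the coefficient of `T ^ K` in `(T - T⁻¹) * p (T + 2 + T⁻¹)`. The Gram determinant does
not change when rows and columns use different monic bases (`det_functional_mul_eq`), so bases are
chosen to make it sparse. The factorisation `T - T⁻¹ = (1 + T⁻¹) * (T - 1)` shares the weight
between rows `X * chebSeq 3 i` and columns built from `chebSeq 1`, so each product is a signed sum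
of four monomials. Adding column indices in steps of `2 * K` then telescopes
(`ballotLinear_X_mul_chebSeq_mul_blockSeq`): below row 0 each column keeps at most a `1` and a `-1`,
and row 0 carries `± j / K`.

Let the last block of columns start at `m * K`. That column meets only row 0, and expanding along it
leaves a minor that is unitriangular up to reversing blocks (`det_sparseBlock`); the factor `m`
comes from row 0. This settles last blocks of length `1` and `K`. For any length strictly between,
the column `m * K + 1` also meets only row 0, so two columns are dependent. -/

section Functional

open Polynomial LaurentPolynomial

/-! ### Chebyshev-type polynomials and their Laurent closed forms -/

/-- The Chebyshev-like polynomials with `s 0 = 1`, `s 1 = X - c` and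
`s (n + 2) = (X - 2) * s (n + 1) - s n`. -/
noncomputable def chebSeq (c : ℚ) : ℕ → ℚ[X]
  | 0 => 1
  | 1 => X - Polynomial.C c
  | n + 2 => (X - 2) * chebSeq c (n + 1) - chebSeq c n

theorem chebSeq_monic_natDegree (c : ℚ) (n : ℕ) :
    (chebSeq c n).Monic ∧ (chebSeq c n).natDegree = n := by
  suffices h : ∀ n, ((chebSeq c n).Monic ∧ (chebSeq c n).natDegree = n) ∧
      ((chebSeq c (n + 1)).Monic ∧ (chebSeq c (n + 1)).natDegree = n + 1) from (h n).1
  intro n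
  induction n with
  | zero =>
    refine ⟨⟨monic_one, natDegree_one⟩, ?_, ?_⟩
    · exact monic_X_sub_C c
    · exact natDegree_X_sub_C c
  | succ n ih =>
    obtain ⟨⟨-, d0⟩, m1, d1⟩ := ih
    refine ⟨⟨m1, d1⟩, ?_⟩
    have hX : (X - 2 : ℚ[X]) = X - Polynomial.C 2 := rfl
    have mX : (X - 2 : ℚ[X]).Monic := hX ▸ monic_X_sub_C 2
    have dX : (X - 2 : ℚ[X]).natDegree = 1 := hX ▸ natDegree_X_sub_C 2
    have m2 : ((X - 2) * chebSeq c (n + 1)).Monic := mX.mul m1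
    have d2 : ((X - 2) * chebSeq c (n + 1)).natDegree = n + 2 := by
      rw [mX.natDegree_mul m1, dX, d1]; ring
    have hlt : (chebSeq c n).degree < ((X - 2) * chebSeq c (n + 1)).degree := by
      apply degree_lt_degree
      rw [d2, d0]; omega
    refine ⟨?_, ?_⟩
    · exact m2.sub_of_left hlt
    · change ((X - 2) * chebSeq c (n + 1) - chebSeq c n).natDegree = _
      rw [natDegree_sub_eq_left_of_natDegree_lt (by omega), d2]

/-- Substitution of `T + 2 + T⁻¹` into a polynomial. -/
noncomputable def toSymmLaurent : ℚ[X] →ₐ[ℚ] ℚ[T;T⁻¹] :=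
  aeval (T 1 + 2 + T (-1))

theorem T_one_mul_T_neg_one : (T 1 * T (-1) : ℚ[T;T⁻¹]) = 1 := by
  rw [← T_add]; simp

theorem toSymmLaurent_X : toSymmLaurent X = T 1 + 2 + T (-1) := by
  simp [toSymmLaurent]

theorem toSymmLaurent_chebSeq_add_two (c : ℚ) (n : ℕ) :
    toSymmLaurent (chebSeq c (n + 2)) =
      (T 1 + T (-1)) * toSymmLaurent (chebSeq c (n + 1)) - toSymmLaurent (chebSeq c n) := by
  rw [chebSeq, map_sub, map_mul, map_sub, toSymmLaurent_X, map_ofNat]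
  ring

/-- The factor `f` clears the denominator of the closed form, so that both sides obey one recurrence
with the same two initial values. -/
theorem mul_toSymmLaurent_chebSeq (c : ℚ) (f : ℚ[T;T⁻¹]) (g : ℤ → ℚ[T;T⁻¹])
    (h0 : f = g 0) (h1 : f * (T 1 + 2 + T (-1) - LaurentPolynomial.C c) = g 1)
    (hg : ∀ n : ℤ, g (n + 2) = (T 1 + T (-1)) * g (n + 1) - g n) (n : ℕ) :
    f * toSymmLaurent (chebSeq c n) = g n := by
  suffices h : ∀ n : ℕ, f * toSymmLaurent (chebSeq c n) = g n ∧
      f * toSymmLaurent (chebSeq c (n + 1)) = g (n + 1) from (h n).1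
  intro n
  induction n with
  | zero =>
    refine ⟨by simp [chebSeq, h0], ?_⟩
    have : toSymmLaurent (Polynomial.C c) = LaurentPolynomial.C c := by
      simp [toSymmLaurent]
    simp [chebSeq, toSymmLaurent_X, this, h1]
  | succ n ih =>
    refine ⟨by exact_mod_cast ih.2, ?_⟩
    rw [toSymmLaurent_chebSeq_add_two]
    have h := hg n
    push_cast
    rw [show (n : ℤ) + 1 + 1 = n + 2 by ring, h, ← ih.1, ← ih.2]
    ring

theorem mul_toSymmLaurent_chebSeq_one (n : ℕ) :
    (T 1 - 1) * toSymmLaurent (chebSeq 1 n) = T ((n : ℤ) + 1) - T (-(n : ℤ)) := by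
  refine mul_toSymmLaurent_chebSeq 1 _ (fun n => T (n + 1) - T (-n)) ?_ ?_ ?_ n
  · simp
  · simp only [map_one]
    rw [show (1 + 1 : ℤ) = 1 + 1 by rfl, T_add]
    linear_combination T_one_mul_T_neg_one
  · intro n
    simp only [T_add, neg_add, show (2 : ℤ) = 1 + 1 by rfl]
    linear_combination (T (-n) - T n * T 1) * T_one_mul_T_neg_one

theorem mul_toSymmLaurent_chebSeq_two (n : ℕ) :
    (T 1 - T (-1)) * toSymmLaurent (chebSeq 2 n) = T ((n : ℤ) + 1) - T (-(n : ℤ) - 1) := by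
  refine mul_toSymmLaurent_chebSeq 2 _ (fun n => T (n + 1) - T (-n - 1)) ?_ ?_ ?_ n
  · simp
  · rw [show (-1 - 1 : ℤ) = -1 + -1 by rfl, T_add, T_add, map_ofNat]
    ring
  · intro n
    simp only [T_add, neg_add, sub_eq_add_neg, show (2 : ℤ) = 1 + 1 by rfl]
    linear_combination (T (-n) * T (-1) - T n * T 1) * T_one_mul_T_neg_one

theorem mul_toSymmLaurent_chebSeq_three (n : ℕ) :
    (1 + T (-1)) * toSymmLaurent (chebSeq 3 n) = T (n : ℤ) + T (-(n : ℤ) - 1) := by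
  refine mul_toSymmLaurent_chebSeq 3 _ (fun n => T n + T (-n - 1)) ?_ ?_ ?_ n
  · simp
  · rw [show (-1 - 1 : ℤ) = -1 + -1 by rfl, T_add, map_ofNat]
    linear_combination T_one_mul_T_neg_one
  · intro n
    simp only [T_add, neg_add, sub_eq_add_neg, show (2 : ℤ) = 1 + 1 by rfl]
    linear_combination (-T n - T (-n) * T (-1)) * T_one_mul_T_neg_one

/-- The functional below is a coefficient extraction only on multiples of `X`; this identity gives
its values on `chebSeq 1` recursively. -/
theorem chebSeq_one_add (n : ℕ) : chebSeq 1 (n + 1) + chebSeq 1 n = X * chebSeq 2 n := by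
  suffices h : ∀ n, chebSeq 1 (n + 1) + chebSeq 1 n = X * chebSeq 2 n ∧
      chebSeq 1 (n + 2) + chebSeq 1 (n + 1) = X * chebSeq 2 (n + 1) from (h n).1
  intro n
  induction n with
  | zero =>
    refine ⟨by simp [chebSeq], ?_⟩
    simp only [chebSeq, map_one, map_ofNat]; ring
  | succ n ih =>
    refine ⟨ih.2, ?_⟩
    have e : ∀ c m, chebSeq c (m + 2) = (X - 2) * chebSeq c (m + 1) - chebSeq c m :=
      fun _ _ => rfl
    rw [e 1 (n + 1), e 2 n]
    linear_combination (X - 2) * ih.2 - ih.1 + e 1 n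

/-! ### The functional and its moments -/

/-- The linear functional on polynomials whose moments are the entries of `ballotHankel`. -/
noncomputable def ballotFunctional (K : ℤ) (p : ℚ[X]) : ℚ :=
  ((T 1 - T (-1)) * toSymmLaurent p.divX : ℚ[T;T⁻¹]).coeff K

theorem ballotFunctional_add (K : ℤ) (p q : ℚ[X]) :
    ballotFunctional K (p + q) = ballotFunctional K p + ballotFunctional K q := by
  simp [ballotFunctional, divX_add, mul_add]

theorem ballotFunctional_C_mul (K : ℤ) (a : ℚ) (p : ℚ[X]) :
    ballotFunctional K (Polynomial.C a * p) = a * ballotFunctional K p := by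
  rw [ballotFunctional, divX_C_mul, ← Polynomial.smul_eq_C_mul, map_smul, mul_smul_comm]
  rfl

/-- `ballotFunctional` as a linear map. -/
noncomputable def ballotLinear (K : ℤ) : ℚ[X] →ₗ[ℚ] ℚ where
  toFun := ballotFunctional K
  map_add' := ballotFunctional_add K
  map_smul' a p := by simp [Polynomial.smul_eq_C_mul, ballotFunctional_C_mul]

theorem ballotLinear_one (K : ℤ) : ballotLinear K 1 = 0 := by
  simp [ballotLinear, ballotFunctional]

theorem ballotLinear_X_mul (K : ℤ) (p : ℚ[X]) :
    ballotLinear K (X * p) = ((T 1 - T (-1)) * toSymmLaurent p : ℚ[T;T⁻¹]).coeff K := by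
  have : (X * p).divX = p := by ext n; simp [coeff_divX]
  simp [ballotLinear, ballotFunctional, this]

theorem symmLaurent_pow (m : ℕ) : (T 1 + 2 + T (-1) : ℚ[T;T⁻¹]) ^ m =
    ∑ l ∈ Finset.range (2 * m + 1), ((2 * m).choose l : ℚ) • T ((l : ℤ) - m) := by
  have h : (T 1 + 2 + T (-1) : ℚ[T;T⁻¹]) = (T 1 + 1) ^ 2 * T (-1) := by
    linear_combination (-T 1 - 2) * T_one_mul_T_neg_one
  rw [h, mul_pow, ← pow_mul, add_pow, Finset.sum_mul]
  refine Finset.sum_congr rfl fun l _ => ?_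
  rw [T_pow, T_pow, one_pow, mul_one, mul_right_comm, ← T_add, LaurentPolynomial.smul_eq_C_mul,
    mul_comm]
  congr 2
  simp [sub_eq_add_neg]

theorem coeff_symmLaurent_pow (m s : ℕ) :
    ((T 1 + 2 + T (-1) : ℚ[T;T⁻¹]) ^ m).coeff (s : ℤ) = ((2 * m).choose (m + s) : ℚ) := by
  rw [symmLaurent_pow]
  simp only [AddMonoidAlgebra.coeff_sum, AddMonoidAlgebra.coeff_smul, Finsupp.finsetSum_apply,
    Finsupp.smul_apply, T_apply, smul_eq_mul, mul_ite, mul_one, mul_zero]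
  have : ∀ l : ℕ, ((l : ℤ) - m = s) ↔ l = m + s := by intro l; omega
  simp only [this, Finset.sum_ite_eq', Finset.mem_range]
  split_ifs with h
  · rfl
  · rw [Nat.choose_eq_zero_of_lt (by omega)]; simp

theorem coeff_T_mul (f : ℚ[T;T⁻¹]) (m n : ℤ) : (T n * f).coeff m = f.coeff (m - n) := by
  rw [T, AddMonoidAlgebra.coeff_single_mul_apply, one_mul, neg_add_eq_sub]

theorem ballotLinear_X_pow_succ (k m : ℕ) :
    ballotLinear ((k : ℤ) + 1) (X ^ (m + 1)) =
      (2 * (k : ℚ) + 2) / ((m : ℚ) + k + 2) * ((2 * m + 1).choose (m + k + 1) : ℚ) := by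
  rw [pow_succ', ballotLinear_X_mul, map_pow, toSymmLaurent_X, sub_mul,
    AddMonoidAlgebra.coeff_sub, Finsupp.sub_apply, coeff_T_mul, coeff_T_mul,
    show (k : ℤ) + 1 - 1 = (k : ℕ) by ring, show (k : ℤ) + 1 - -1 = (k + 2 : ℕ) by push_cast; ring,
    coeff_symmLaurent_pow, coeff_symmLaurent_pow]
  have e1 := Nat.choose_succ_succ (2 * m) (m + k)
  have e2 := Nat.choose_succ_succ (2 * m) (m + k + 1)
  have e3 := Nat.choose_succ_right_eq (2 * m + 1) (m + k + 1)
  simp only [Nat.succ_eq_add_one] at e1 e2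
  have e4 : ((2 * m + 1).choose (m + k + 2) : ℚ) * (m + k + 2) =
      (2 * m + 1).choose (m + k + 1) * ((m : ℚ) - k) := by
    -- For `k > m` the natural subtraction in `e3` truncates, but both binomials vanish.
    rcases le_or_gt k m with h | h
    · have : 2 * m + 1 - (m + k + 1) = m - k := by omega
      rw [this] at e3
      have e5 := congrArg (Nat.cast : ℕ → ℚ) e3
      push_cast [Nat.cast_sub h] at e5
      linear_combination e5
    · rw [Nat.choose_eq_zero_of_lt (by omega : 2 * m + 1 < m + k + 1),
        Nat.choose_eq_zero_of_lt (by omega : 2 * m + 1 < m + k + 2)]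
      simp
  have hpos : (m : ℚ) + k + 2 ≠ 0 := by positivity
  have e1' : ((2 * m + 1).choose (m + k + 1) : ℚ) =
      (2 * m).choose (m + k) + (2 * m).choose (m + k + 1) := by exact_mod_cast e1
  have e2' : ((2 * m + 1).choose (m + k + 2) : ℚ) =
      (2 * m).choose (m + k + 1) + (2 * m).choose (m + k + 2) := by exact_mod_cast e2
  rw [show m + (k + 2) = m + k + 2 by ring, div_mul_eq_mul_div, eq_div_iff hpos]
  linear_combination (-(m : ℚ) - k - 2) * e1' + (m + k + 2 : ℚ) * e2' - e4

theorem ballotHankel_apply (n k : ℕ) (i j : Fin n) :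
    ballotHankel n k i j = ballotLinear ((k : ℤ) + 1) (X ^ ((i : ℕ) + j)) := by
  rw [ballotHankel, Matrix.of_apply]
  split_ifs with h
  · simp [h.1, h.2, ballotLinear_one]
  · obtain ⟨m, hm⟩ : ∃ m, (i : ℕ) + j = m + 1 := ⟨(i : ℕ) + j - 1, by omega⟩
    rw [hm, ballotLinear_X_pow_succ]
    have h1 : ((i : ℕ) : ℚ) + ((j : ℕ) : ℚ) = m + 1 := by exact_mod_cast hm
    rw [h1, show 2 * (i : ℕ) + 2 * (j : ℕ) - 1 = 2 * m + 1 by omega,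
      show m + 1 + k = m + k + 1 by ring]
    congr 2
    ring

/-! ### Change of monic bases -/

/-- The Gram determinant of a linear functional does not depend on the choice of monic bases. -/
theorem det_functional_mul_eq (n : ℕ) (L : ℚ[X] →ₗ[ℚ] ℚ) (p q : Fin n → ℚ[X])
    (hp : ∀ i, (p i).Monic) (hpd : ∀ i, (p i).natDegree = i)
    (hq : ∀ i, (q i).Monic) (hqd : ∀ i, (q i).natDegree = i) :
    (Matrix.of fun i j => L (p i * q j)).det =
      (Matrix.of fun i j : Fin n => L (X ^ ((i : ℕ) + j))).det := by
  have expand : ∀ r : Fin n → ℚ[X], (∀ i, (r i).natDegree = i) → ∀ i,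
      r i = ∑ s : Fin n, (r i).coeff s • X ^ (s : ℕ) := by
    intro r hr i
    conv_lhs => rw [(r i).as_sum_range' n (by rw [hr]; exact i.2)]
    rw [Finset.sum_range]
    simp [smul_X_eq_monomial]
  have key : (Matrix.of fun i j => L (p i * q j)) =
      (Matrix.of fun s i : Fin n => (p i).coeff s).transpose *
        (Matrix.of fun i j : Fin n => L (X ^ ((i : ℕ) + j))) *
        Matrix.of fun s j : Fin n => (q j).coeff s := by
    ext i j
    rw [Matrix.mul_assoc]
    simp only [Matrix.of_apply, Matrix.mul_apply, Matrix.transpose_apply]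
    conv_lhs => rw [expand p hpd i, expand q hqd j, Finset.sum_mul, map_sum]
    refine Finset.sum_congr rfl fun s _ => ?_
    rw [Finset.mul_sum, map_sum, Finset.mul_sum]
    refine Finset.sum_congr rfl fun t _ => ?_
    rw [smul_mul_smul_comm, map_smul, ← pow_add, smul_eq_mul]
    ring
  rw [key, Matrix.det_mul, Matrix.det_mul, Matrix.det_transpose,
    Matrix.det_matrixOfPolynomials p hpd hp, Matrix.det_matrixOfPolynomials q hqd hq]
  ring

/-! ### Column polynomials and telescoping -/

/-- `chebSeq 1` extended to integer indices by antisymmetry about `-1/2`. -/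
noncomputable def antisymmSeq (j : ℤ) : ℚ[X] :=
  if 0 ≤ j then chebSeq 1 j.toNat else -chebSeq 1 (-1 - j).toNat

theorem antisymmSeq_natCast (n : ℕ) : antisymmSeq n = chebSeq 1 n := by
  simp [antisymmSeq]

theorem antisymmSeq_neg (j : ℤ) : antisymmSeq (-1 - j) = -antisymmSeq j := by
  unfold antisymmSeq
  split_ifs <;> first | omega | simp

theorem mul_toSymmLaurent_antisymmSeq (j : ℤ) :
    (T 1 - 1) * toSymmLaurent (antisymmSeq j) = T (j + 1) - T (-j) := by
  rcases le_or_gt 0 j with h | h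
  · lift j to ℕ using h
    rw [antisymmSeq_natCast, mul_toSymmLaurent_chebSeq_one]
  · obtain ⟨n, rfl⟩ : ∃ n : ℕ, j = -1 - n := ⟨(-1 - j).toNat, by omega⟩
    rw [antisymmSeq_neg, antisymmSeq_natCast, map_neg, mul_neg, mul_toSymmLaurent_chebSeq_one,
      neg_sub]
    congr 2 <;> ring

theorem degree_antisymmSeq_lt {j : ℤ} {d : ℕ} (h1 : j < d) (h2 : -1 - j < d) :
    (antisymmSeq j).degree < d := by
  unfold antisymmSeq
  have hd : ∀ n : ℕ, n < d → (chebSeq 1 n).degree < d := fun n hn => by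
    rw [degree_eq_natDegree (chebSeq_monic_natDegree 1 n).1.ne_zero,
      (chebSeq_monic_natDegree 1 n).2]
    exact_mod_cast hn
  split_ifs
  · exact hd _ (by omega)
  · rw [degree_neg]; exact hd _ (by omega)

theorem ballotLinear_X_mul_chebSeq_mul (K : ℤ) (i : ℕ) (j : ℤ) :
    ballotLinear K (X * chebSeq 3 i * antisymmSeq j) =
      (if (i : ℤ) + 1 = K - j then 1 else 0) - (if (i : ℤ) + 1 = K + j + 1 then 1 else 0)
      + (if (i : ℤ) + 1 = j + 1 - K then 1 else 0) - (if (i : ℤ) + 1 = -j - K then 1 else 0) := by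
  have h : (T 1 - T (-1)) * toSymmLaurent (chebSeq 3 i * antisymmSeq j) =
      (T (i : ℤ) + T (-(i : ℤ) - 1)) * (T (j + 1) - T (-j)) := by
    rw [← mul_toSymmLaurent_chebSeq_three, ← mul_toSymmLaurent_antisymmSeq, map_mul]
    linear_combination toSymmLaurent (chebSeq 3 i) * toSymmLaurent (antisymmSeq j) *
      -T_one_mul_T_neg_one
  rw [mul_assoc, ballotLinear_X_mul, h, mul_sub, add_mul, add_mul]
  simp only [← T_add, AddMonoidAlgebra.coeff_sub, AddMonoidAlgebra.coeff_add, Finsupp.sub_apply,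
    Finsupp.add_apply, T_apply]
  have c1 : (i : ℤ) + (j + 1) = K ↔ (i : ℤ) + 1 = K - j := by omega
  have c2 : -(i : ℤ) - 1 + (j + 1) = K ↔ (i : ℤ) + 1 = j + 1 - K := by omega
  have c3 : (i : ℤ) + -j = K ↔ (i : ℤ) + 1 = K + j + 1 := by omega
  have c4 : -(i : ℤ) - 1 + -j = K ↔ (i : ℤ) + 1 = -j - K := by omega
  simp only [c1, c2, c3, c4]
  ring

theorem ballotLinear_chebSeq_one_succ (K n : ℕ) (hK : 0 < K) :
    ballotLinear K (chebSeq 1 (n + 1)) =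
      (if n + 1 = K then 1 else 0) - ballotLinear K (chebSeq 1 n) := by
  rw [eq_sub_iff_add_eq, ← map_add, chebSeq_one_add, ballotLinear_X_mul,
    mul_toSymmLaurent_chebSeq_two]
  simp only [AddMonoidAlgebra.coeff_sub, Finsupp.sub_apply, T_apply]
  rw [if_neg (by omega : ¬ (-(n : ℤ) - 1 = K)), sub_zero]
  norm_cast

theorem ballotLinear_chebSeq_one (K n : ℕ) (hK : 0 < K) :
    ballotLinear K (chebSeq 1 n) = if K ≤ n then (-1) ^ (n + K) else 0 := by
  induction n with
  | zero => simp [chebSeq, ballotLinear_one, hK.ne']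
  | succ n ih =>
    rw [ballotLinear_chebSeq_one_succ K n hK, ih]
    rcases lt_trichotomy (n + 1) K with h | h | h
    · rw [if_neg (by omega), if_neg (by omega), if_neg (by omega)]; simp
    · rw [if_pos h, if_neg (by omega), if_pos (by omega), h, ← two_mul, pow_mul]; simp
    · rw [if_neg (by omega), if_pos (by omega), if_pos (by omega)]; ring

/-- The column polynomials, `∑ t ≤ a, S ((a - 2 t) K + b)` where `S = antisymmSeq`. -/
noncomputable def blockSeq (K a b : ℕ) : ℚ[X] :=
  ∑ t ∈ Finset.range (a + 1), antisymmSeq (((a : ℤ) - 2 * t) * K + b)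

theorem blockSeq_monic_natDegree (K a b : ℕ) (hK : 0 < K) :
    (blockSeq K a b).Monic ∧ (blockSeq K a b).natDegree = a * K + b := by
  rw [blockSeq, Finset.sum_range_succ']
  have h0 : antisymmSeq (((a : ℤ) - 2 * (0 : ℕ)) * K + b) = chebSeq 1 (a * K + b) := by
    rw [← antisymmSeq_natCast]; congr 1
  rw [h0]
  obtain ⟨hm, hd⟩ := chebSeq_monic_natDegree 1 (a * K + b)
  have hlt : (∑ t ∈ Finset.range a, antisymmSeq (((a : ℤ) - 2 * (t + 1 : ℕ)) * K + b)).degree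
      < (chebSeq 1 (a * K + b)).degree := by
    rw [degree_eq_natDegree hm.ne_zero, hd]
    refine (degree_sum_le _ _).trans_lt ?_
    rw [Finset.sup_lt_iff (WithBot.bot_lt_coe _)]
    intro t ht
    have ht' : (t : ℤ) + 1 ≤ a := by have := Finset.mem_range.1 ht; omega
    have hK' : (0 : ℤ) < K := by exact_mod_cast hK
    apply degree_antisymmSeq_lt
    · push_cast; nlinarith [mul_nonneg (Int.natCast_nonneg t) hK'.le]
    · push_cast; nlinarith [mul_nonneg (sub_nonneg.2 ht') hK'.le]
  refine ⟨hm.add_of_right hlt, ?_⟩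
  rw [natDegree_add_eq_right_of_degree_lt hlt, hd]

theorem ballotLinear_antisymmSeq_natCast (K s : ℕ) (hK : 0 < K) :
    ballotLinear K (antisymmSeq s) = if K ≤ s then (-1) ^ (s + K) else 0 := by
  rw [antisymmSeq_natCast, ballotLinear_chebSeq_one K s hK]

theorem blockSeq_add_two (K a b : ℕ) :
    blockSeq K (a + 2) b = blockSeq K a b + antisymmSeq ((a + 2 : ℕ) * K + b) +
      antisymmSeq (-(a + 2 : ℕ) * K + b) := by
  rw [blockSeq, Finset.sum_range_succ, Finset.sum_range_succ', blockSeq]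
  congr 2
  · refine Finset.sum_congr rfl fun t _ => ?_
    congr 1; push_cast; ring
  · congr 1; push_cast; ring

/-- Passing from `a` to `a + 2` adds the two outermost terms, whose values are equal signs, hence
growth by 2; the parity of the exponent is unaffected. -/
theorem ballotLinear_blockSeq (K a b : ℕ) (hb : b < K) :
    ballotLinear K (blockSeq K a b) = (-1) ^ ((a + 1) * K + b) * a := by
  have hK : 0 < K := by omega
  have hpos : ∀ a : ℕ, 1 ≤ a → ballotLinear K (antisymmSeq ((a : ℤ) * K + b)) =
      (-1) ^ ((a + 1) * K + b) := by
    intro a ha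
    rw [show (a : ℤ) * K + b = (a * K + b : ℕ) by push_cast; ring,
      ballotLinear_antisymmSeq_natCast K _ hK, if_pos (by nlinarith)]
    congr 1; ring
  -- Reflection sends this index to `a * K + (K - 1 - b)`, which is below the threshold `K` exactly
  -- when `a = 0`.
  have hneg : ∀ a : ℕ, ballotLinear K (antisymmSeq (-((a + 1 : ℕ) : ℤ) * K + b)) =
      if a = 0 then 0 else (-1) ^ (a * K + b) := by
    intro a
    rw [show -((a + 1 : ℕ) : ℤ) * K + b = -1 - (a * K + (K - 1 - b) : ℕ) by
        push_cast [Nat.cast_sub (show b ≤ K - 1 by omega), Nat.cast_sub hK]; ring,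
      antisymmSeq_neg, map_neg, ballotLinear_antisymmSeq_natCast K _ hK]
    rcases Nat.eq_zero_or_pos a with rfl | ha
    · rw [if_neg (by omega)]; simp
    · rw [if_pos (by nlinarith), if_neg ha.ne', ← mul_neg_one, ← pow_succ]
      obtain ⟨c, rfl⟩ : ∃ c, K = b + 1 + c := ⟨K - (b + 1), by omega⟩
      rw [show b + 1 + c - 1 - b = c by omega,
        show a * (b + 1 + c) + c + (b + 1 + c) + 1 = a * (b + 1 + c) + b + 2 * (c + 1) by ring,
        pow_add, pow_mul (-1 : ℚ) 2]
      simp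
  induction a using Nat.twoStepInduction with
  | zero =>
    simp only [blockSeq, zero_add, Finset.sum_range_one]
    rw [show ((0 : ℕ) - 2 * (0 : ℕ) : ℤ) * K + b = (b : ℕ) by simp,
      ballotLinear_antisymmSeq_natCast K _ hK, if_neg (by omega)]
    simp
  | one =>
    have h1 := hpos 1 le_rfl
    have h2 := hneg 0
    rw [blockSeq, Finset.sum_range_succ, Finset.sum_range_one, map_add,
      show (((1 : ℕ) : ℤ) - 2 * (0 : ℕ)) * K + b = ((1 : ℕ) : ℤ) * K + b by simp,
      show (((1 : ℕ) : ℤ) - 2 * (1 : ℕ)) * K + b = -((0 + 1 : ℕ) : ℤ) * K + b by simp,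
      h1, h2]
    simp
  | more a ih _ =>
    rw [blockSeq_add_two, map_add, map_add, ih, hpos (a + 2) (by omega), hneg (a + 1),
      if_neg (by omega)]
    have e : (-1 : ℚ) ^ ((a + 2 + 1) * K + b) = (-1) ^ ((a + 1) * K + b) := by
      rw [show (a + 2 + 1) * K + b = (a + 1) * K + b + 2 * K by ring, pow_add,
        pow_mul (-1 : ℚ) 2]
      simp
    rw [e]
    push_cast
    ring

theorem ballotLinear_X_mul_chebSeq_mul_blockSeq (K a b i : ℕ) (hb : b < K) :
    ballotLinear K (X * chebSeq 3 i * blockSeq K a b) =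
      (if i + 1 + b = (a + 1) * K then 1 else 0) -
        (if i + 1 = (a + 1) * K + b + 1 then 1 else 0) := by
  -- Replacing `t` by `t + 1` lowers the index by `2 * K`, which matches the four indicators in two
  -- telescoping pairs; the surviving ends are `g 0` and `h (a + 1)`.
  set g : ℕ → ℚ := fun t =>
    if (i : ℤ) + 1 = ((a : ℤ) - 2 * t + 1) * K + b + 1 then 1 else 0 with hg
  set h : ℕ → ℚ := fun t =>
    if (i : ℤ) + 1 = (2 * (t : ℤ) - a - 1) * K - b then 1 else 0 with hh
  have term : ∀ t : ℕ, ballotLinear K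
      (X * chebSeq 3 i * antisymmSeq (((a : ℤ) - 2 * t) * K + b)) =
      (g (t + 1) - g t) + (h (t + 1) - h t) := by
    intro t
    rw [ballotLinear_X_mul_chebSeq_mul]
    simp only [hg, hh]
    have c1 : (K : ℤ) - (((a : ℤ) - 2 * t) * K + b) = (2 * ((t + 1 : ℕ) : ℤ) - a - 1) * K - b := by
      push_cast; ring
    have c2 : (K : ℤ) + (((a : ℤ) - 2 * t) * K + b) + 1 = ((a : ℤ) - 2 * t + 1) * K + b + 1 := by
      ring
    have c3 : ((a : ℤ) - 2 * t) * K + b + 1 - K =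
        ((a : ℤ) - 2 * ((t + 1 : ℕ) : ℤ) + 1) * K + b + 1 := by push_cast; ring
    have c4 : -(((a : ℤ) - 2 * t) * K + b) - K = (2 * (t : ℤ) - a - 1) * K - b := by ring
    rw [c1, c2, c3, c4]
    ring
  rw [blockSeq, Finset.mul_sum, map_sum, Finset.sum_congr rfl fun t _ => term t,
    Finset.sum_add_distrib, Finset.sum_range_sub, Finset.sum_range_sub]
  have e1 : g (a + 1) = 0 := by
    simp only [hg]
    rw [if_neg]
    push_cast
    nlinarith [mul_nonneg (Int.natCast_nonneg a) (Int.natCast_nonneg K)]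
  have e2 : h 0 = 0 := by
    simp only [hh]
    rw [if_neg]
    push_cast
    nlinarith [mul_nonneg (Int.natCast_nonneg a) (Int.natCast_nonneg K)]
  have e3 : g 0 = if i + 1 = (a + 1) * K + b + 1 then 1 else 0 := by
    simp only [hg]
    congr 1
    rw [eq_iff_iff]; zify; simp
  have e4 : h (a + 1) = if i + 1 + b = (a + 1) * K then 1 else 0 := by
    simp only [hh]
    congr 1
    rw [eq_iff_iff]; zify
    rw [show (2 * ((a : ℤ) + 1) - a - 1) * K - b = ((a : ℤ) + 1) * K - b by ring]
    exact eq_sub_iff_add_eq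
  rw [e1, e2, e3, e4]
  ring

/-! ### The sparse Gram matrix -/

/-- The Gram matrix entries of `ballotLinear` in the sparse bases. -/
def sparseEntry (K i j : ℕ) : ℚ :=
  if i = 0 then (-1) ^ ((j / K + 1) * K + j % K) * ((j / K : ℕ) : ℚ)
  else (if i + j % K = (j / K + 1) * K then 1 else 0) -
    (if i = (j / K + 1) * K + j % K + 1 then 1 else 0)

/-- The row polynomials. -/
noncomputable def rowSeq : ℕ → ℚ[X]
  | 0 => 1
  | i + 1 => X * chebSeq 3 i

theorem rowSeq_monic_natDegree (i : ℕ) : (rowSeq i).Monic ∧ (rowSeq i).natDegree = i := by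
  rcases i with _ | i
  · exact ⟨monic_one, natDegree_one⟩
  · obtain ⟨hm, hd⟩ := chebSeq_monic_natDegree 3 i
    refine ⟨monic_X.mul hm, ?_⟩
    rw [rowSeq, monic_X.natDegree_mul hm, hd, natDegree_X, add_comm]

/-- The column polynomials, indexed by their degree. -/
noncomputable def colSeq (K j : ℕ) : ℚ[X] := blockSeq K (j / K) (j % K)

theorem colSeq_monic_natDegree (K j : ℕ) (hK : 0 < K) :
    (colSeq K j).Monic ∧ (colSeq K j).natDegree = j := by
  have h := blockSeq_monic_natDegree K (j / K) (j % K) hK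
  exact ⟨h.1, h.2.trans (Nat.div_add_mod' j K)⟩

theorem ballotLinear_rowSeq_mul_colSeq (K i j : ℕ) (hK : 0 < K) :
    ballotLinear K (rowSeq i * colSeq K j) = sparseEntry K i j := by
  have hb := Nat.mod_lt j hK
  rcases i with _ | i
  · rw [rowSeq, one_mul, colSeq, ballotLinear_blockSeq _ _ _ hb, sparseEntry, if_pos rfl]
  · rw [rowSeq, colSeq, ballotLinear_X_mul_chebSeq_mul_blockSeq _ _ _ _ hb, sparseEntry,
      if_neg i.succ_ne_zero]

theorem det_ballotHankel_eq (n k : ℕ) :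
    (ballotHankel n k).det =
      (Matrix.of fun i j : Fin n => sparseEntry (k + 1) i j).det := by
  have hK : 0 < k + 1 := k.succ_pos
  have hA : ballotHankel n k =
      Matrix.of fun i j : Fin n => ballotLinear ((k + 1 : ℕ) : ℤ) (X ^ ((i : ℕ) + j)) := by
    ext i j
    rw [ballotHankel_apply, Matrix.of_apply, Nat.cast_succ]
  have hB : (Matrix.of fun i j : Fin n => sparseEntry (k + 1) i j) =
      Matrix.of fun i j : Fin n =>
        ballotLinear ((k + 1 : ℕ) : ℤ) (rowSeq i * colSeq (k + 1) j) := by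
    ext i j
    rw [Matrix.of_apply, Matrix.of_apply, ballotLinear_rowSeq_mul_colSeq _ _ _ hK]
  rw [hA, hB]
  exact (det_functional_mul_eq n _ (fun i => rowSeq i) (fun j => colSeq (k + 1) j)
    (fun i => (rowSeq_monic_natDegree i).1) (fun i => (rowSeq_monic_natDegree i).2)
    (fun j => (colSeq_monic_natDegree _ j hK).1) (fun j => (colSeq_monic_natDegree _ j hK).2)).symm

end Functional

/-! ### Determinant of the sparse matrix -/

section Determinant

open Matrix

theorem det_antidiagonal (K : ℕ) :
    (Matrix.of fun i j : Fin K => if (i : ℕ) + j + 1 = K then (1 : ℚ) else 0).det =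
      (-1) ^ K.choose 2 := by
  induction K with
  | zero => simp
  | succ K ih =>
    rw [det_succ_column_zero, Finset.sum_eq_single (Fin.last K)]
    · have hsub : (Matrix.of fun i j : Fin (K + 1) =>
          if (i : ℕ) + j + 1 = K + 1 then (1 : ℚ) else 0).submatrix
            (Fin.last K).succAbove Fin.succ =
          Matrix.of fun i j : Fin K => if (i : ℕ) + j + 1 = K then (1 : ℚ) else 0 := by
        ext i j
        simp only [submatrix_apply, of_apply, Fin.succAbove_last, Fin.val_castSucc, Fin.val_succ]
        congr 1
        rw [eq_iff_iff]; omega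
      rw [hsub, ih]
      simp [Nat.choose_succ_succ' K 1, pow_add]
    · intro i _ hi
      have : (i : ℕ) ≠ K := fun h => hi (Fin.ext h)
      simp [this]
    · simp

theorem sign_revPerm (K : ℕ) : (Equiv.Perm.sign (Fin.revPerm : Equiv.Perm (Fin K)) : ℤ) =
    (-1) ^ K.choose 2 := by
  have h := Matrix.det_permutation (R := ℚ) (Fin.revPerm : Equiv.Perm (Fin K))
  have e : (Equiv.toPEquiv (Fin.revPerm : Equiv.Perm (Fin K))).toMatrix =
      Matrix.of fun i j : Fin K => if (i : ℕ) + j + 1 = K then (1 : ℚ) else 0 := by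
    ext i j
    simp [PEquiv.toMatrix_apply, Fin.ext_iff]
    congr 1
    rw [eq_iff_iff]; omega
  rw [Equiv.Perm.permMatrix, e, det_antidiagonal] at h
  exact_mod_cast h.symm

/-- The permutation of `Fin (m * K)` reversing each block of length `K`. -/
def blockRev (m K : ℕ) : Equiv.Perm (Fin (m * K)) :=
  finProdFinEquiv.permCongr (Equiv.prodCongrRight fun _ => Fin.revPerm)

theorem sign_blockRev (m K : ℕ) :
    ((Equiv.Perm.sign (blockRev m K) : ℤ) : ℚ) = (-1) ^ (m * K.choose 2) := by
  rw [blockRev, Equiv.Perm.sign_permCongr, Equiv.Perm.sign_prodCongrRight, Finset.prod_const,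
    Finset.card_univ, Fintype.card_fin]
  push_cast
  rw [sign_revPerm]
  push_cast
  rw [← pow_mul, mul_comm]

theorem blockRev_val (m K : ℕ) (j : Fin (m * K)) :
    ((blockRev m K j : Fin (m * K)) : ℕ) = (j : ℕ) / K * K + (K - 1 - (j : ℕ) % K) := by
  simp [blockRev, Equiv.permCongr_apply, finProdFinEquiv]
  rw [mul_comm K, add_comm]
  congr 1
  omega

/-- Rows `1, …, m K` and columns `0, …, m K - 1` of the sparse Gram matrix. -/
def sparseBlock (m K : ℕ) : Matrix (Fin (m * K)) (Fin (m * K)) ℚ :=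
  Matrix.of fun i j => sparseEntry K (i + 1) j

/-- Block reversal moves the `1`s to the diagonal; the `-1`s land in the next block of rows, hence
strictly below it. -/
theorem det_sparseBlock (m K : ℕ) (hK : 0 < K) :
    (sparseBlock m K).det = (-1) ^ (m * K.choose 2) := by
  have entry : ∀ i j, (sparseBlock m K).submatrix id (blockRev m K) i j =
      (if i = j then 1 else 0) -
        (if (i : ℕ) = ((j : ℕ) / K + 1) * K + (K - 1 - (j : ℕ) % K) then 1 else 0) := by
    intro i j
    have hb := Nat.mod_lt (j : ℕ) hK
    have hdiv : ((blockRev m K j : Fin (m * K)) : ℕ) / K = (j : ℕ) / K := by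
      rw [blockRev_val, mul_comm ((j : ℕ) / K) K, Nat.mul_add_div hK,
        Nat.div_eq_of_lt (show K - 1 - (j : ℕ) % K < K by omega), add_zero]
    have hmod : ((blockRev m K j : Fin (m * K)) : ℕ) % K = K - 1 - (j : ℕ) % K := by
      rw [blockRev_val, mul_comm ((j : ℕ) / K) K, Nat.mul_add_mod, Nat.mod_eq_of_lt (by omega)]
    rw [submatrix_apply, id, sparseBlock, of_apply, sparseEntry, if_neg (Nat.succ_ne_zero _),
      hdiv, hmod]
    have := Nat.div_add_mod' (j : ℕ) K
    congr 2
    · rw [eq_iff_iff, Fin.ext_iff, add_mul, one_mul]; omega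
    · rw [eq_iff_iff, add_mul, one_mul]; omega
  have htri : ((sparseBlock m K).submatrix id (blockRev m K)).det = 1 := by
    rw [det_of_isLowerTriangular]
    · refine Finset.prod_eq_one fun i _ => ?_
      have := Nat.div_add_mod' (i : ℕ) K
      have hb := Nat.mod_lt (i : ℕ) hK
      rw [entry, if_pos rfl, if_neg, sub_zero]
      rw [add_mul, one_mul]; omega
    · intro i j hij
      have hij' : (i : ℕ) < j := hij
      have := Nat.div_add_mod' (j : ℕ) K
      have hb := Nat.mod_lt (j : ℕ) hK
      rw [entry, if_neg (by rw [Fin.ext_iff]; omega), if_neg, sub_zero]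
      rw [add_mul, one_mul]; omega
  rw [det_permute', sign_blockRev] at htri
  have hsq : ((-1 : ℚ) ^ (m * K.choose 2)) * (-1) ^ (m * K.choose 2) = 1 := by
    rw [← mul_pow]; simp
  exact (mul_left_cancel₀ (left_ne_zero_of_mul_eq_one hsq) (htri.trans hsq.symm))

theorem sparseEntry_zero_mul (K m : ℕ) (hK : 0 < K) :
    sparseEntry K 0 (m * K) = (-1) ^ ((m + 1) * K) * m := by
  simp [sparseEntry, Nat.mul_div_cancel _ hK]

theorem sparseEntry_eq_zero {K i m b : ℕ} (hb : b < K) (h0 : i ≠ 0) (hi : i + b < (m + 1) * K) :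
    sparseEntry K i (m * K + b) = 0 := by
  have h1 : (m * K + b) / K = m := by
    rw [mul_comm, Nat.mul_add_div (by omega), Nat.div_eq_of_lt hb, add_zero]
  have h2 : (m * K + b) % K = b := by
    rw [mul_comm, Nat.mul_add_mod, Nat.mod_eq_of_lt hb]
  rw [sparseEntry, if_neg h0, h1, h2, if_neg (by omega), if_neg (by omega), sub_zero]

theorem det_sparse_mul_add_one (m K : ℕ) (hK : 0 < K) :
    (Matrix.of fun i j : Fin (m * K + 1) => sparseEntry K i j).det =
      (-1) ^ (m * K.choose 2 + K) * m := by
  rw [det_succ_column _ (Fin.last _), Finset.sum_eq_single 0]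
  · have hsub : (Matrix.of fun i j : Fin (m * K + 1) => sparseEntry K i j).submatrix
        (Fin.succAbove 0) (Fin.last _).succAbove = sparseBlock m K := by
      ext i j
      simp [sparseBlock]
    rw [hsub, det_sparseBlock m K hK, of_apply, Fin.val_last, Fin.val_zero,
      sparseEntry_zero_mul K m hK]
    have : (-1 : ℚ) ^ (m * K) * (-1) ^ (m * K) = 1 := by rw [← mul_pow]; simp
    rw [zero_add, add_mul, one_mul, pow_add, pow_add]
    linear_combination (m * (-1) ^ K * (-1) ^ (m * K.choose 2)) * this
  · intro i _ hi
    have hi0 : (i : ℕ) ≠ 0 := fun h => hi (Fin.ext h)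
    have hlt := i.2
    have := sparseEntry_eq_zero (K := K) (i := i) (m := m) (b := 0) hK hi0
      (by rw [add_mul, one_mul]; omega)
    rw [of_apply, Fin.val_last]
    simp only [add_zero] at this
    simp [this]
  · simp

theorem det_sparse_mul (m K N : ℕ) (hK : 0 < K) (hN : N = (m + 1) * K) :
    (Matrix.of fun i j : Fin N => sparseEntry K i j).det =
      (-1) ^ ((m + 1) * K.choose 2 + 1) * m := by
  subst hN
  have hF := det_sparseBlock (m + 1) K hK
  rw [sparseBlock] at hF
  obtain ⟨N, hN⟩ : ∃ N, (m + 1) * K = N + 1 := ⟨(m + 1) * K - 1, by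
    have : 0 < (m + 1) * K := Nat.mul_pos m.succ_pos hK
    omega⟩
  rw [hN] at hF ⊢
  have hN' : m * K + K = N + 1 := by rw [← hN]; ring
  let c : Fin (N + 1) := ⟨m * K, by omega⟩
  have zero_of : ∀ i : ℕ, i ≠ 0 → i < N + 1 → sparseEntry K i (m * K) = 0 := fun i h0 h =>
    sparseEntry_eq_zero (b := 0) hK h0 (by omega)
  have last_entry : sparseEntry K (N + 1) (m * K) = 1 := by
    rw [sparseEntry, if_neg (Nat.succ_ne_zero _), Nat.mul_div_cancel _ hK, Nat.mul_mod_left,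
      if_pos (by omega), if_neg (by omega), sub_zero]
  -- The minor sought is also the minor of the shifted matrix obtained by deleting its last row and
  -- column `c`. Expanding the known determinant along `c`, where only the last row survives,
  -- evaluates it.
  rw [det_succ_column _ c, Finset.sum_eq_single (Fin.last N)] at hF
  · rw [det_succ_column _ c, Finset.sum_eq_single 0]
    · have hsub : (Matrix.of fun i j : Fin (N + 1) => sparseEntry K i j).submatrix
          (Fin.succAbove 0) c.succAbove =
          (Matrix.of fun i j : Fin (N + 1) => sparseEntry K (i + 1) j).submatrix
            (Fin.last N).succAbove c.succAbove := by
        ext i j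
        simp
      rw [hsub, of_apply, Fin.val_zero, sparseEntry_zero_mul K m hK]
      rw [of_apply, Fin.val_last, last_entry] at hF
      have hc : ((c : Fin (N + 1)) : ℕ) = m * K := rfl
      rw [hc] at hF ⊢
      have e1 : (-1 : ℚ) ^ (N + m * K) = -((-1) ^ ((m + 1) * K) * (-1) ^ (0 + m * K)) := by
        rw [hN, zero_add]; ring
      rw [pow_succ (-1 : ℚ), ← hF, e1]
      ring
    · intro i _ hi
      have hi0 : (i : ℕ) ≠ 0 := fun h => hi (Fin.ext h)
      have : (Matrix.of fun i j : Fin (N + 1) => sparseEntry K i j) i c = 0 :=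
        zero_of i hi0 i.2
      rw [this]; simp
    · simp
  · intro i _ hi
    have hi0 : (i : ℕ) ≠ N := fun h => hi (Fin.ext h)
    have : (Matrix.of fun i j : Fin (N + 1) => sparseEntry K (i + 1) j) i c = 0 :=
      zero_of (i + 1) (Nat.succ_ne_zero _) (by have := i.2; omega)
    rw [this]; simp
  · simp

theorem det_sparse_eq_zero (m K c : ℕ) (hc : 2 ≤ c) (hcK : c < K) :
    (Matrix.of fun i j : Fin (m * K + c) => sparseEntry K i j).det = 0 := by
  let x : Fin (m * K + c) := ⟨m * K + 0, by omega⟩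
  let y : Fin (m * K + c) := ⟨m * K + 1, by omega⟩
  by_contra hdet
  set M := Matrix.of fun i j : Fin (m * K + c) => sparseEntry K i j with hM
  have hinj : ∀ v, M *ᵥ v = 0 → v = 0 := fun v => Matrix.eq_zero_of_mulVec_eq_zero hdet
  have zero_of : ∀ i : Fin (m * K + c), ∀ b, b ≤ 1 → (i : ℕ) ≠ 0 →
      sparseEntry K i (m * K + b) = 0 := fun i b hb h0 =>
    sparseEntry_eq_zero (by omega) h0 (by have := i.2; rw [add_mul, one_mul]; omega)
  have hxy : x ≠ y := fun h => by simpa [x, y] using congrArg Fin.val h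
  have key : ∀ v w : ℚ, v * sparseEntry K 0 (m * K + 0) + w * sparseEntry K 0 (m * K + 1) = 0 →
      v = 0 ∧ w = 0 := by
    intro v w h
    have hv := hinj (Pi.single x v + Pi.single y w) (by
      ext i
      rw [mulVec_add, Pi.add_apply, mulVec_single, mulVec_single]
      have ex : M i x = sparseEntry K i (m * K + 0) := rfl
      have ey : M i y = sparseEntry K i (m * K + 1) := rfl
      by_cases h0 : (i : ℕ) = 0
      · simp only [Pi.smul_apply, col_apply, ex, ey, h0]
        simpa [mul_comm] using h
      · have zx : M i x = 0 := zero_of i 0 zero_le_one h0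
        have zy : M i y = 0 := zero_of i 1 le_rfl h0
        simp only [Pi.smul_apply, col_apply, zx, zy, smul_zero, add_zero, Pi.zero_apply])
    have h1 := congrFun hv x
    have h2 := congrFun hv y
    exact ⟨by simpa [hxy] using h1, by simpa [hxy.symm] using h2⟩
  -- For two columns supported on row 0 with entries `p` and `q`, the vector `(q, -p)` lies in the
  -- kernel. Injectivity forces `p = 0`, and then `(1, 0)` is a nonzero kernel vector.
  have h1 := key (sparseEntry K 0 (m * K + 1)) (-sparseEntry K 0 (m * K + 0)) (by ring)
  have h2 := key 1 0 (by rw [neg_eq_zero.1 h1.2]; ring)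
  exact one_ne_zero h2.1

end Determinant

theorem theorem19 (n k : ℕ) (hn : 1 ≤ n) :
    (∀ n₁ : ℕ, n = (k + 1) * n₁ →
      (ballotHankel n k).det = (-1 : ℚ) ^ (n₁ * Nat.choose (k + 1) 2 + 1) * ((n₁ : ℚ) - 1)) ∧
    (∀ n₁ : ℕ, n = (k + 1) * n₁ + 1 →
      (ballotHankel n k).det = (-1 : ℚ) ^ (n₁ * Nat.choose (k + 1) 2 + k + 1) * (n₁ : ℚ)) ∧
    (¬ n ≡ 0 [MOD k + 1] → ¬ n ≡ 1 [MOD k + 1] → (ballotHankel n k).det = 0) := by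
  rw [det_ballotHankel_eq]
  refine ⟨?_, ?_, ?_⟩
  · intro n₁ h
    obtain ⟨m, rfl⟩ : ∃ m, n₁ = m + 1 := Nat.exists_eq_succ_of_ne_zero (by rintro rfl; omega)
    rw [det_sparse_mul m (k + 1) n k.succ_pos (by rw [h, mul_comm])]
    push_cast
    ring
  · rintro n₁ rfl
    rw [mul_comm (k + 1) n₁, det_sparse_mul_add_one n₁ (k + 1) k.succ_pos, add_assoc]
  · intro h0 h1
    have hlt : n % (k + 1) < k + 1 := Nat.mod_lt n k.succ_pos
    have h0' : n % (k + 1) ≠ 0 := fun h => h0 (by simpa [Nat.ModEq] using h)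
    have h1' : n % (k + 1) ≠ 1 := fun h => h1 (by
      rw [Nat.ModEq, h, Nat.mod_eq_of_lt (h.symm.trans_lt hlt)])
    have := det_sparse_eq_zero (n / (k + 1)) (k + 1) (n % (k + 1)) (by omega) hlt
    rwa [Nat.div_add_mod'] at this
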